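/- Let $g:\mathbb R^n\to\mathbb R\cup\{+\infty\}$ be proper, lower semicontinuous and convex, and let $\omega:\mathbb R^n\to\mathbb R$ be convex and continuously differentiable with Lipschitz gradient, and 1-coercive, i.e. $\omega(x)/\|x\|\to+\infty$ as $\|x\|\to\infty$. For $\mu>0$ put $\omega_\mu(y):=\mu\,\omega(y/\mu)$ and $$s_g(x,\mu):=(g\#\omega_\mu)(x)=\inf_{u\in\mathbb R^n}\{g(u)+\omega_\mu(x-u)\}.$$ Below, $\mu_k\downarrow0$ means $\mu_k>0$ and $\mu_k\to0$; $\operatorname{epi}f=\{(x,\alpha)\in\mathbb R^n\times\mathbb R\mid f(x)\le\alpha\}$ and $\operatorname{gph}S=\{(x,y)\mid y\in S(x)\}$ denote epigraph and graph, and $\operatorname{dom}g=\{x\mid g(x)<+\infty\}$. The limiting subdifferential $\partial g(\bar x)$ at $\bar x\in\operatorname{dom}g$ is the set of all limits of sequences $v^k\in\hat\partial g(x^k)$ with $x^k\to\bar x$ and $g(x^k)\to g(\bar x)$, where $\hat\partial g(x)$ is, for $x\in\operatorname{dom}g$, the set of all $v$ with $g(y)\ge g(x)+v^T(y-x)+o(\|y-x\|)$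 as $y\to x$; both sets are empty at points outside $\operatorname{dom}g$. Then $s_g$ is real-valued on $\mathbb R^n\times(0,\infty)$ and is an epi-smoothing function for $g$, that is: (i) for every sequence $\mu_k\downarrow0$, the functions $s_g(\cdot,\mu_k)$ epi-converge to $g$, i.e. $\operatorname{epi}s_g(\cdot,\mu_k)\to\operatorname{epi}g$ in the sense of Painlevé–Kuratowski; (ii) $s_g(\cdot,\mu)$ is continuously differentiable for every $\mu>0$. Moreover, for every sequence $\mu_k\downarrow0$, $$\operatorname{gph}\nabla_x s_g(\cdot,\mu_k)\to\operatorname{gph}\partial g$$ in the sense of Painlevé–Kuratowski, and in particular, for every $\bar x\in\operatorname{dom}g$, $$\mathop{\mathrm{Lim\,sup}}_{\mu\downarrow0,\;x\to\bar x}\nabla_x s_g(x,\mu)=\partial g(\bar x),$$ where the left-hand side is the set of all limits of convergent sequences $\nabla_x s_g(x^k,\mu_k)$ with $x^k\to\bar x$ and $\mu_k\downarrow0$. -/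

import Mathlib

open Filter Topology Asymptotics

noncomputable section

namespace EpiSmoothing

/-! ### Set convergence, graphs and epigraphs -/

/-- Painlevé–Kuratowski outer limit of a sequence of sets: the limits of sequences of points chosen
from a subsequence of the sets. -/
def outerLim {X : Type*} [TopologicalSpace X] (C : ℕ → Set X) : Set X :=
  {x | ∃ φ : ℕ → ℕ, StrictMono φ ∧ ∃ y : ℕ → X, (∀ k, y k ∈ C (φ k)) ∧ Tendsto y atTop (𝓝 x)}

/-- Painlevé–Kuratowski inner limit of a sequence of sets: the limits of sequences of points chosen
from all but finitely many of the sets. -/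
def innerLim {X : Type*} [TopologicalSpace X] (C : ℕ → Set X) : Set X :=
  {x | ∃ y : ℕ → X, (∀ᶠ k in atTop, y k ∈ C k) ∧ Tendsto y atTop (𝓝 x)}

/-- Painlevé–Kuratowski convergence of a sequence of sets: outer and inner limit both equal `D`. -/
def SetConverges {X : Type*} [TopologicalSpace X] (C : ℕ → Set X) (D : Set X) : Prop :=
  outerLim C = D ∧ innerLim C = D

/-- The outer limit `Limsup S(x)` of a set-valued map `S`, where `x` tends along the filter `l`:
all limits of sequences `v k ∈ S (x k)` with `x k` tending along `l`. -/
def mapLimsup {X Y : Type*} [TopologicalSpace Y] (S : X → Set Y) (l : Filter X) : Set Y :=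
  {v | ∃ x : ℕ → X, Tendsto x atTop l ∧
    ∃ w : ℕ → Y, (∀ k, w k ∈ S (x k)) ∧ Tendsto w atTop (𝓝 v)}

/-- The graph of a set-valued map. -/
def gph {X Y : Type*} (S : X → Set Y) : Set (X × Y) := {p | p.2 ∈ S p.1}

/-- The epigraph of an extended real-valued function, a subset of `X × ℝ`. -/
def epi {X : Type*} (f : X → EReal) : Set (X × ℝ) := {p | f p.1 ≤ (p.2 : EReal)}

/-- The domain of an extended real-valued function. -/
def dom {X : Type*} (f : X → EReal) : Set X := {x | f x < ⊤}

/-- Epi-convergence: the epigraphs converge in the sense of Painlevé–Kuratowski. -/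
def EpiConverges {X : Type*} [TopologicalSpace X] (f : ℕ → X → EReal) (f₀ : X → EReal) : Prop :=
  SetConverges (fun k => epi (f k)) (epi f₀)

/-- `f` takes values in `ℝ ∪ {+∞}` and is not identically `+∞`. -/
def Proper {X : Type*} (f : X → EReal) : Prop := (∀ x, f x ≠ ⊥) ∧ (dom f).Nonempty

/-! ### Subdifferentials -/

section Subdifferential

variable {E : Type*} [NormedAddCommGroup E] [InnerProductSpace ℝ E]

/-- The regular subdifferential of `f : E → ℝ ∪ {+∞}` at `x₀`: all `v` with
`f x ≥ f x₀ + ⟨v, x - x₀⟩ + o(‖x - x₀‖)`. It is empty outside the domain of `f`. -/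
def regularSubdiff (f : E → EReal) (x₀ : E) : Set E :=
  {v | x₀ ∈ dom f ∧ ∃ r : E → ℝ, r =o[𝓝 x₀] (fun x => ‖x - x₀‖) ∧
    ∀ᶠ x in 𝓝 x₀, f x₀ + ((inner ℝ v (x - x₀) + r x : ℝ) : EReal) ≤ f x}

/-- The limiting subdifferential of `f : E → ℝ ∪ {+∞}` at `x₀`: the outer limit of the regular
subdifferentials at `x`, as `x → x₀` and `f x → f x₀`. It is empty outside the domain of `f`. -/
def limitingSubdiff (f : E → EReal) (x₀ : E) : Set E :=
  {v | x₀ ∈ dom f ∧ v ∈ mapLimsup (regularSubdiff f) (𝓝 x₀ ⊓ comap f (𝓝 (f x₀)))}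

end Subdifferential

/-! ### Epi-smoothing functions and infimal convolution -/

section Smoothing

variable {E : Type*} [NormedAddCommGroup E] [InnerProductSpace ℝ E]

/-- `s x μ` is an epi-smoothing function for `f`: `s (·, μₖ)` epi-converges to `f` for all
sequences `μₖ ↓ 0` of positive numbers, and `s (·, μ)` is continuously differentiable for `μ > 0`.
Only the values of `s` at `μ > 0` matter. -/
def IsEpiSmoothing (s : E → ℝ → ℝ) (f : E → EReal) : Prop :=
  (∀ μ : ℕ → ℝ, Tendsto μ atTop (𝓝[>] 0) →
    EpiConverges (fun k x => ((s x (μ k) : ℝ) : EReal)) f) ∧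
  ∀ μ : ℝ, 0 < μ → ContDiff ℝ 1 (fun x => s x μ)

/-- Infimal convolution `(f₁ # f₂) x = inf_u (f₁ u + f₂ (x - u))`, for functions that do not take
the value `-∞`. -/
def infConv (f₁ f₂ : E → EReal) (x : E) : EReal := ⨅ u : E, f₁ u + f₂ (x - u)

/-- `ω_μ y = μ ω (y / μ)`. -/
def rescale (ω : E → ℝ) (μ : ℝ) (y : E) : ℝ := μ * ω (μ⁻¹ • y)

/-- `ω` is 1-coercive: `ω x / ‖x‖ → +∞` as `‖x‖ → ∞`. -/
def OneCoercive (ω : E → ℝ) : Prop :=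
  Tendsto (fun x => ω x / ‖x‖) (Bornology.cobounded E) atTop

/-- The real-valued function `(x, μ) ↦ (g # ω_μ) x`. It is meaningful where the infimal convolution
is finite, which has to be proved. -/
def infConvSmoothing (g : E → EReal) (ω : E → ℝ) (x : E) (μ : ℝ) : ℝ :=
  (infConv g (fun y => ((rescale ω μ y : ℝ) : EReal)) x).toReal

/-- The single-valued map `x ↦ ∇ₓ s (x, μ)`, as a set-valued map. -/
def gradMap [CompleteSpace E] (s : E → ℝ → ℝ) (μ : ℝ) (x : E) : Set E :=
  {gradient (fun y => s y μ) x}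

end Smoothing

end EpiSmoothing

end

open EpiSmoothing

/-!
For `μ > 0` the infimum defining `(g # ω_μ) x` is attained at some `u`: `g` has an affine minorant
`⟨p, ·⟩ - β` (`exists_affine_minorant`), and the coercive `ω_μ` outgrows it. Write
`v = ∇ω ((x - u) / μ)`. Fermat's rule at `u` gives `v ∈ ∂g(u)`
(`IsProx.gradient_mem_convexSubdiff`), and by convexity it characterizes `u`
(`isProx_of_gradient_mem`).

*Smoothness.* Adding the subgradient inequalities of `g` at `u` and of `ω_μ` at `x - u` bounds the
smoothing from below by its tangent with slope `v` at `x`; the competitor `u` in the infimum at `y`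
bounds it from above by the same tangent plus a multiple of `‖y - x‖²`. Hence `v` is the gradient at
`x`, and having these bounds at every point makes the gradient Lipschitz
(`norm_sub_le_of_quadratic_bounds`).

*Epi-limits.* Since `ω` outgrows `M ‖·‖` for each `M`, points that nearly attain the infimum satisfy
`(M - ‖p‖) ‖x - u‖ ≤ const`, uniformly as `μ ↓ 0` (`norm_sub_le_of_value_le`). So proximal points
converge together with `x`, and lower semicontinuity of `g` gives the outer limit. The inner limit
uses `u = x`.

*Graphical limits.* If gradients `v = ∇ω z` with `z = (x - u) / μ` stay bounded, coercivity bounds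
`z`, so `u = x - μ z` converges with `x`, and the graph of `∂g` is closed
(`mem_convexSubdiff_of_tendsto_gradient`). Conversely `∇ω` is onto, and if `v ∈ ∂g(x)` and
`∇ω z = v`, then the smoothing has gradient exactly `v` at `x + μ z`
(`exists_gradient_infConvSmoothing_eq`). The limiting subdifferential of a convex function is that
of convex analysis (`limitingSubdiff_eq_convexSubdiff`).
-/

namespace EpiSmoothing

variable {E : Type*} [NormedAddCommGroup E] [InnerProductSpace ℝ E]

/-! ### The subdifferential of a convex function -/

theorem Proper.exists_coe {X : Type*} {g : X → EReal} (hg : Proper g) {x : X} (hx : x ∈ dom g) :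
    ∃ a : ℝ, g x = a :=
  ⟨(g x).toReal, (EReal.coe_toReal (ne_of_lt hx) (hg.1 x)).symm⟩

theorem Proper.exists_le_coe {X : Type*} {g : X → EReal} (hg : Proper g) :
    ∃ (x : X) (a : ℝ), g x ≤ a := by
  obtain ⟨x, hx⟩ := hg.2
  obtain ⟨a, ha⟩ := hg.exists_coe hx
  exact ⟨x, a, ha.le⟩

/-- The subdifferential of convex analysis: all `v` with `g y ≥ g x + ⟨v, y - x⟩` for every `y`.
It is phrased through the points `(y, b)` of the epigraph, so that only real numbers are added. -/
def convexSubdiff (g : E → EReal) (x : E) : Set E :=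
  {v | ∃ a : ℝ, g x = a ∧ ∀ (y : E) (b : ℝ), g y ≤ b → a + inner ℝ v (y - x) ≤ b}

theorem isClosed_epi {X : Type*} [TopologicalSpace X] {g : X → EReal}
    (hg : LowerSemicontinuous g) : IsClosed (epi g) :=
  hg.isClosed_epigraph.preimage
    (continuous_fst.prodMk (continuous_coe_real_ereal.comp continuous_snd))

theorem le_of_tendsto_epi {X : Type*} [TopologicalSpace X] {g : X → EReal}
    (hg : LowerSemicontinuous g) {x : ℕ → X} {b : ℕ → ℝ} {x₀ : X} {b₀ : ℝ}
    (hx : Tendsto x atTop (𝓝 x₀)) (hb : Tendsto b atTop (𝓝 b₀))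
    (h : ∀ᶠ k in atTop, g (x k) ≤ b k) : g x₀ ≤ b₀ :=
  (isClosed_epi hg).mem_of_tendsto (hx.prodMk_nhds hb) h

/-- Convexity of `g` along a segment, in terms of points of the epigraph. -/
theorem le_segment {g : E → EReal} (hg : Convex ℝ (epi g)) {x y : E} {a b t : ℝ}
    (hx : g x ≤ a) (hy : g y ≤ b) (ht₀ : 0 ≤ t) (ht₁ : t ≤ 1) :
    g (x + t • (y - x)) ≤ ((a + t * (b - a) : ℝ) : EReal) := by
  have hmem := hg.add_smul_sub_mem (x := (x, a)) (y := (y, b)) hx hy ⟨ht₀, ht₁⟩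
  simpa [epi] using hmem

theorem mem_convexSubdiff_of_tendsto {g : E → EReal} (hgp : Proper g)
    (hg : LowerSemicontinuous g) {x v : ℕ → E} {x₀ v₀ : E}
    (hx : Tendsto x atTop (𝓝 x₀)) (hv : Tendsto v atTop (𝓝 v₀))
    (h : ∀ᶠ k in atTop, v k ∈ convexSubdiff g (x k)) : v₀ ∈ convexSubdiff g x₀ := by
  have key : ∀ (y : E) (b : ℝ), g y ≤ b → g x₀ ≤ ((b - inner ℝ v₀ (y - x₀) : ℝ) : EReal) := by
    intro y b hy
    refine le_of_tendsto_epi hg hx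
      (tendsto_const_nhds.sub (hv.inner (tendsto_const_nhds.sub hx))) ?_
    filter_upwards [h] with k hk
    obtain ⟨a, ha, hk⟩ := hk
    rw [ha, EReal.coe_le_coe_iff]
    linarith [hk y b hy]
  obtain ⟨y, b, hy⟩ := hgp.exists_le_coe
  obtain ⟨a, ha⟩ := hgp.exists_coe (x := x₀) ((key y b hy).trans_lt (EReal.coe_lt_top _))
  refine ⟨a, ha, fun y b hy => ?_⟩
  have := key y b hy
  rw [ha, EReal.coe_le_coe_iff] at this
  linarith

theorem convexSubdiff_subset_regularSubdiff (g : E → EReal) (x : E) :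
    convexSubdiff g x ⊆ regularSubdiff g x := by
  rintro v ⟨a, ha, hv⟩
  refine ⟨by simp [dom, ha], 0, isLittleO_zero _ _, Eventually.of_forall fun y => ?_⟩
  rw [ha, ← EReal.coe_add]
  refine EReal.le_of_forall_lt_iff_le.1 fun b hb => ?_
  rw [EReal.coe_le_coe_iff]
  simpa using hv y b hb.le

theorem regularSubdiff_subset_convexSubdiff {g : E → EReal} (hgp : Proper g)
    (hg : Convex ℝ (epi g)) (x : E) : regularSubdiff g x ⊆ convexSubdiff g x := by
  rintro v ⟨hx, r, hr, hv⟩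
  obtain ⟨a, ha⟩ := hgp.exists_coe hx
  refine ⟨a, ha, fun y b hy => ?_⟩
  have htend : Tendsto (fun t : ℝ => x + t • (y - x)) (𝓝[>] 0) (𝓝 x) := by
    have : Continuous fun t : ℝ => x + t • (y - x) := by fun_prop
    simpa using (this.tendsto 0).mono_left nhdsWithin_le_nhds
  -- The estimate at `x + t (y - x)`, divided by `t`, with the remainder bounded by `ε t ‖y - x‖`.
  have key : ∀ ε : ℝ, 0 < ε → a + inner ℝ v (y - x) - b ≤ ε * ‖y - x‖ := by
    intro ε hε
    have ht₁ : ∀ᶠ t : ℝ in 𝓝[>] 0, t < 1 := nhdsWithin_le_nhds (gt_mem_nhds one_pos)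
    have ht₀ : ∀ᶠ t : ℝ in 𝓝[>] 0, 0 < t := self_mem_nhdsWithin
    obtain ⟨t, ht, h₁, h₂, ht₁⟩ := (ht₀.and
      ((htend.eventually hv).and ((htend.eventually (hr.def hε)).and ht₁))).exists
    have h₃ := h₁.trans (le_segment hg ha.le hy ht.le ht₁.le)
    rw [ha, ← EReal.coe_add, EReal.coe_le_coe_iff] at h₃
    simp only [add_sub_cancel_left, inner_smul_right, norm_smul, Real.norm_eq_abs,
      abs_of_pos ht, abs_mul, abs_norm] at h₂ h₃
    have h₄ := neg_abs_le (r (x + t • (y - x)))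
    refine le_of_mul_le_mul_left ?_ ht
    linarith
  have hlim : Tendsto (fun ε : ℝ => ε * ‖y - x‖) (𝓝[>] 0) (𝓝 0) := by
    have : Continuous fun ε : ℝ => ε * ‖y - x‖ := by fun_prop
    simpa using (this.tendsto 0).mono_left nhdsWithin_le_nhds
  have := ge_of_tendsto hlim (eventually_nhdsWithin_of_forall key)
  linarith

/-- For a convex lower semicontinuous function the limiting subdifferential is that of convex
analysis, since the latter contains the regular subdifferential and has a closed graph. -/
theorem limitingSubdiff_eq_convexSubdiff {g : E → EReal} (hgp : Proper g)
    (hg : LowerSemicontinuous g) (hgc : Convex ℝ (epi g)) :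
    limitingSubdiff g = convexSubdiff g := by
  ext x v
  constructor
  · rintro ⟨-, y, hy, w, hw, hwv⟩
    exact mem_convexSubdiff_of_tendsto hgp hg (hy.mono_right inf_le_left) hwv
      (Eventually.of_forall fun k => regularSubdiff_subset_convexSubdiff hgp hgc _ (hw k))
  · intro hv
    have hreg := convexSubdiff_subset_regularSubdiff g x hv
    refine ⟨hreg.1, fun _ => x, ?_, fun _ => v, fun _ => hreg, tendsto_const_nhds⟩
    exact tendsto_inf.2 ⟨tendsto_const_nhds, tendsto_comap_iff.2 tendsto_const_nhds⟩

/-- A convex lower semicontinuous proper function has an affine minorant; this separates its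
epigraph from a point below it. -/
theorem exists_affine_minorant [CompleteSpace E] {g : E → EReal} (hgp : Proper g)
    (hg : LowerSemicontinuous g) (hgc : Convex ℝ (epi g)) :
    ∃ (p : E) (β : ℝ), ∀ (y : E) (b : ℝ), g y ≤ b → inner ℝ p y - β ≤ b := by
  obtain ⟨x, hx⟩ := hgp.2
  obtain ⟨a, ha⟩ := hgp.exists_coe hx
  have hnot : (x, a - 1) ∉ epi g := by
    simp only [epi, Set.mem_ofPred_eq, ha, EReal.coe_le_coe_iff]
    linarith
  obtain ⟨f, c, hfx, hf⟩ := geometric_hahn_banach_point_closed hgc (isClosed_epi hg) hnot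
  set m : ℝ := f (0, 1) with hm
  set q : E := (InnerProductSpace.toDual ℝ E).symm (f.comp (ContinuousLinearMap.inl ℝ E ℝ)) with hq
  have hsplit : ∀ (y : E) (b : ℝ), f (y, b) = inner ℝ q y + b * m := by
    intro y b
    have h₁ : (y, b) = (y, (0 : ℝ)) + b • ((0 : E), (1 : ℝ)) := by simp
    rw [h₁, map_add, map_smul, hq, InnerProductSpace.toDual_symm_apply]
    simp [hm]
  have hmpos : 0 < m := by
    have := hf (x, a) ha.le
    rw [hsplit] at this hfx
    linarith
  refine ⟨-(m⁻¹ • q), -(m⁻¹ * c), fun y b hy => ?_⟩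
  have h := hf (y, b) hy
  rw [hsplit] at h
  rw [inner_neg_left, real_inner_smul_left]
  refine le_of_mul_le_mul_left ?_ hmpos
  field_simp
  linarith

/-! ### The convex kernel -/

theorem convexOn_gradient_le [CompleteSpace E] {ω : E → ℝ} (hc : ConvexOn ℝ Set.univ ω)
    (hd : Differentiable ℝ ω) (x y : E) : ω x + inner ℝ (gradient ω x) (y - x) ≤ ω y := by
  have hline : HasDerivAt (fun t : ℝ => ω (x + t • (y - x)))
      (inner ℝ (gradient ω x) (y - x)) 0 := by
    have h₁ : HasDerivAt (fun t : ℝ => x + t • (y - x)) (y - x) 0 := by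
      simpa using ((hasDerivAt_id (0 : ℝ)).smul_const (y - x)).const_add x
    have h₂ := (hd x).hasGradientAt.hasFDerivAt
    have h₃ : HasFDerivAt ω (InnerProductSpace.toDual ℝ E (gradient ω x))
        (x + (0 : ℝ) • (y - x)) := by simpa using h₂
    exact h₃.comp_hasDerivAt (0 : ℝ) h₁
  have hconv : ConvexOn ℝ Set.univ (fun t : ℝ => ω (x + t • (y - x))) := by
    have := hc.comp_affineMap (AffineMap.lineMap (k := ℝ) x y)
    simpa [Function.comp_def, AffineMap.lineMap_apply, add_comm] using this
  have := hconv.le_slope_of_hasDerivAt (Set.mem_univ 0) (Set.mem_univ 1) one_pos hline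
  simp only [slope_def_field, one_smul, zero_smul, add_zero, add_sub_cancel, sub_zero,
    div_one] at this
  linarith

/-- The descent inequality, with a constant that is not optimal: convexity at `y` bounds the
increment by `⟨∇ω y, y - x⟩`. -/
theorem le_add_gradient_add_sq [CompleteSpace E] {ω : E → ℝ} (hc : ConvexOn ℝ Set.univ ω)
    (hd : Differentiable ℝ ω) {L : NNReal} (hL : LipschitzWith L (gradient ω)) (x y : E) :
    ω y ≤ ω x + inner ℝ (gradient ω x) (y - x) + L * ‖y - x‖ ^ 2 := by
  have h₁ := convexOn_gradient_le hc hd y x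
  have h₂ : inner ℝ (gradient ω y - gradient ω x) (y - x) ≤ L * ‖y - x‖ ^ 2 := by
    refine (real_inner_le_norm _ _).trans ?_
    have := hL.norm_sub_le y x
    nlinarith [norm_nonneg (y - x)]
  rw [inner_sub_left] at h₂
  rw [← neg_sub y x, inner_neg_right] at h₁
  linarith

theorem OneCoercive.exists_le {F : Type*} [NormedAddCommGroup F] [ProperSpace F] {ω : F → ℝ}
    (h : OneCoercive ω) (hω : Continuous ω) (M : ℝ) : ∃ C : ℝ, ∀ z, M * ‖z‖ - C ≤ ω z := by
  have hev := h.eventually_ge_atTop M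
  rw [← comap_norm_atTop, eventually_comap] at hev
  obtain ⟨R, hR⟩ := eventually_atTop.1 hev
  obtain ⟨C, hC⟩ := ((isCompact_closedBall (0 : F) (max R 1)).image
    (f := fun z => M * ‖z‖ - ω z) (by fun_prop)).bddAbove
  refine ⟨max C 0, fun z => ?_⟩
  rcases le_total ‖z‖ (max R 1) with hz | hz
  · have := hC ⟨z, by simpa using hz, rfl⟩
    linarith [le_max_left C 0]
  · have h₁ := hR ‖z‖ ((le_max_left R 1).trans hz) z rfl
    rw [le_div_iff₀ (one_pos.trans_le ((le_max_right R 1).trans hz))] at h₁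
    linarith [le_max_right C 0]

/-- By coercivity the gradient of `ω` is onto: `ω - ⟨v, ·⟩` has a minimizer. -/
theorem OneCoercive.exists_gradient_eq [ProperSpace E] {ω : E → ℝ} (h : OneCoercive ω)
    (hd : Differentiable ℝ ω) (v : E) : ∃ z, gradient ω z = v := by
  obtain ⟨C, hC⟩ := h.exists_le hd.continuous (‖v‖ + 1)
  have htend : Tendsto (fun z => ω z - inner ℝ v z) (cocompact E) atTop := by
    refine tendsto_atTop_mono (f := fun z => ‖z‖ - C) (fun z => ?_)
      (tendsto_atTop_add_const_right _ _ tendsto_norm_cocompact_atTop)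
    have := real_inner_le_norm v z
    linarith [hC z]
  have hcont : Continuous fun z => ω z - inner ℝ v z := by
    have := hd.continuous
    fun_prop
  obtain ⟨z, hz⟩ := hcont.exists_forall_le htend
  have h₁ : HasFDerivAt (fun z => ω z - inner ℝ v z) (InnerProductSpace.toDual ℝ E (gradient ω z) -
      InnerProductSpace.toDual ℝ E v) z :=
    (hd z).hasGradientAt.hasFDerivAt.sub (InnerProductSpace.toDual ℝ E v).hasFDerivAt
  have h₂ := IsLocalMin.hasFDerivAt_eq_zero (Eventually.of_forall hz) h₁
  rw [sub_eq_zero] at h₂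
  exact ⟨z, (InnerProductSpace.toDual ℝ E).injective h₂⟩

theorem rescale_add_inner_le [CompleteSpace E] {ω : E → ℝ} (hc : ConvexOn ℝ Set.univ ω)
    (hd : Differentiable ℝ ω) {μ : ℝ} (hμ : 0 < μ) (x y : E) :
    rescale ω μ x + inner ℝ (gradient ω (μ⁻¹ • x)) (y - x) ≤ rescale ω μ y := by
  have h := mul_le_mul_of_nonneg_left (convexOn_gradient_le hc hd (μ⁻¹ • x) (μ⁻¹ • y)) hμ.le
  rw [← smul_sub, inner_smul_right, mul_add, mul_inv_cancel_left₀ hμ.ne'] at h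
  exact h

theorem rescale_le_add_inner_add_sq [CompleteSpace E] {ω : E → ℝ} (hc : ConvexOn ℝ Set.univ ω)
    (hd : Differentiable ℝ ω) {L : NNReal} (hL : LipschitzWith L (gradient ω)) {μ : ℝ}
    (hμ : 0 < μ) (x y : E) : rescale ω μ y ≤
      rescale ω μ x + inner ℝ (gradient ω (μ⁻¹ • x)) (y - x) + L / μ * ‖y - x‖ ^ 2 := by
  have h := mul_le_mul_of_nonneg_left (le_add_gradient_add_sq hc hd hL (μ⁻¹ • x) (μ⁻¹ • y)) hμ.le
  rw [← smul_sub, inner_smul_right, norm_smul, Real.norm_of_nonneg (inv_pos.2 hμ).le, mul_add,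
    mul_add, mul_inv_cancel_left₀ hμ.ne'] at h
  refine h.trans_eq ?_
  simp only [rescale]
  field_simp

theorem rescale_ge {ω : E → ℝ} {M C : ℝ} (h : ∀ z, M * ‖z‖ - C ≤ ω z) {μ : ℝ} (hμ : 0 < μ)
    (y : E) : M * ‖y‖ - μ * C ≤ rescale ω μ y := by
  have h₁ := mul_le_mul_of_nonneg_left (h (μ⁻¹ • y)) hμ.le
  rw [norm_smul, Real.norm_of_nonneg (inv_pos.2 hμ).le] at h₁
  refine le_trans (le_of_eq ?_) h₁
  field_simp

/-! ### Proximal points -/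

/-- `u` attains the infimum that defines `(g # ω_μ) x`, and the minimal value is finite. -/
def IsProx (g : E → EReal) (ω : E → ℝ) (μ : ℝ) (x u : E) : Prop :=
  ∃ a : ℝ, g u = a ∧ ∀ (y : E) (b : ℝ), g y ≤ b → a + rescale ω μ (x - u) ≤ b + rescale ω μ (x - y)

/-- Control of near-minimizers: the affine minorant `⟨p, ·⟩ - β` of `g` loses against the growth
`M` of `ω` once `M > ‖p‖`. The bound is uniform as `μ ↓ 0`. -/
theorem norm_sub_le_of_value_le {g : E → EReal} {ω : E → ℝ} {p : E} {β M C : ℝ}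
    (hp : ∀ (y : E) (b : ℝ), g y ≤ b → inner ℝ p y - β ≤ b) (hM : ∀ z, M * ‖z‖ - C ≤ ω z)
    {μ : ℝ} (hμ : 0 < μ) {x u : E} {b α : ℝ} (hu : g u ≤ b) (hα : b + rescale ω μ (x - u) ≤ α) :
    (M - ‖p‖) * ‖x - u‖ ≤ α + β + ‖p‖ * ‖x‖ + μ * C := by
  have h₁ := hp u b hu
  have h₂ := rescale_ge hM hμ (x - u)
  have h₃ : inner ℝ p (x - u) ≤ ‖p‖ * ‖x - u‖ := real_inner_le_norm _ _
  have h₄ := neg_le_of_abs_le (abs_real_inner_le_norm p x)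
  rw [inner_sub_right] at h₃
  linarith

theorem exists_isProx [ProperSpace E] {g : E → EReal} {ω : E → ℝ} (hgp : Proper g)
    (hg : LowerSemicontinuous g) (hgc : Convex ℝ (epi g)) (hω : Continuous ω)
    (hωc : OneCoercive ω) {μ : ℝ} (hμ : 0 < μ) (x : E) : ∃ u, IsProx g ω μ x u := by
  obtain ⟨p, β, hp⟩ := exists_affine_minorant hgp hg hgc
  obtain ⟨C, hC⟩ := hωc.exists_le hω (‖p‖ + 1)
  obtain ⟨x₁, a₁, hx₁⟩ := hgp.exists_le_coe
  -- The minimization runs over the epigraph, where the objective is real and continuous.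
  let F : E × ℝ → ℝ := fun q => q.2 + rescale ω μ (x - q.1)
  have hF : Continuous F := by unfold F rescale; fun_prop
  set α := F (x₁, a₁)
  set S : Set (E × ℝ) := epi g ∩ F ⁻¹' Set.Iic α
  have hSclosed : IsClosed S := (isClosed_epi hg).inter (isClosed_Iic.preimage hF)
  set R := α + β + ‖p‖ * ‖x‖ + μ * C
  have hSsub : S ⊆ Metric.closedBall x R ×ˢ Set.Icc (-(‖p‖ * (‖x‖ + R)) - β) (α + μ * C) := by
    rintro ⟨u, b⟩ ⟨hu, hub⟩
    have hu : g u ≤ b := hu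
    have hub : b + rescale ω μ (x - u) ≤ α := hub
    have h₁ := norm_sub_le_of_value_le hp hC hμ hu hub
    rw [add_sub_cancel_left, one_mul] at h₁
    have h₂ : ‖u‖ ≤ ‖x‖ + R := by
      have := norm_sub_norm_le u x
      rw [norm_sub_rev] at this
      linarith
    have h₃ := mul_le_mul_of_nonneg_left h₂ (norm_nonneg p)
    have h₄ := neg_le_of_abs_le (abs_real_inner_le_norm p u)
    have h₅ := rescale_ge hC hμ (x - u)
    have h₆ : 0 ≤ (‖p‖ + 1) * ‖x - u‖ := by positivity
    refine ⟨?_, ?_, ?_⟩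
    · rwa [Metric.mem_closedBall, dist_comm, dist_eq_norm]
    · linarith [hp u b hu]
    · linarith
  have hScompact : IsCompact S :=
    ((isCompact_closedBall x R).prod isCompact_Icc).of_isClosed_subset hSclosed hSsub
  obtain ⟨⟨u, b⟩, ⟨hu, hub⟩, hmin⟩ :=
    hScompact.exists_isMinOn ⟨(x₁, a₁), hx₁, le_refl α⟩ hF.continuousOn
  have hu : g u ≤ b := hu
  obtain ⟨a, ha⟩ := hgp.exists_coe (x := u) (hu.trans_lt (EReal.coe_lt_top b))
  rw [ha, EReal.coe_le_coe_iff] at hu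
  refine ⟨u, a, ha, fun y c hy => ?_⟩
  have hle : b + rescale ω μ (x - u) ≤ c + rescale ω μ (x - y) := by
    rcases le_total (F (y, c)) α with h | h
    · exact hmin ⟨hy, h⟩
    · exact le_trans hub h
  linarith

theorem IsProx.infConv_eq {g : E → EReal} {ω : E → ℝ} (hgp : Proper g) {μ : ℝ} {x u : E} {a : ℝ}
    (h : IsProx g ω μ x u) (ha : g u = a) :
    infConv g (fun y => ((rescale ω μ y : ℝ) : EReal)) x =
      ((a + rescale ω μ (x - u) : ℝ) : EReal) := by
  obtain ⟨a', ha', hmin⟩ := h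
  obtain rfl : a = a' := EReal.coe_injective (ha.symm.trans ha')
  refine le_antisymm ((iInf_le _ u).trans_eq (by rw [ha, EReal.coe_add])) (le_iInf fun y => ?_)
  rcases eq_or_ne (g y) ⊤ with hy | hy
  · simp [hy]
  · obtain ⟨b, hb⟩ := hgp.exists_coe (x := y) (lt_top_iff_ne_top.2 hy)
    rw [hb, ← EReal.coe_add, EReal.coe_le_coe_iff]
    exact hmin y b hb.le

theorem IsProx.infConvSmoothing_eq {g : E → EReal} {ω : E → ℝ} (hgp : Proper g) {μ : ℝ} {x u : E}
    {a : ℝ} (h : IsProx g ω μ x u) (ha : g u = a) :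
    infConvSmoothing g ω x μ = a + rescale ω μ (x - u) := by
  rw [infConvSmoothing, h.infConv_eq hgp ha, EReal.toReal_coe]

theorem infConvSmoothing_le [ProperSpace E] {g : E → EReal} {ω : E → ℝ} (hgp : Proper g)
    (hg : LowerSemicontinuous g) (hgc : Convex ℝ (epi g)) (hω : Continuous ω)
    (hωc : OneCoercive ω) {μ : ℝ} (hμ : 0 < μ) (x : E) {y : E} {b : ℝ} (hy : g y ≤ b) :
    infConvSmoothing g ω x μ ≤ b + rescale ω μ (x - y) := by
  obtain ⟨u, hu⟩ := exists_isProx hgp hg hgc hω hωc hμ x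
  obtain ⟨a, ha, hmin⟩ := id hu
  rw [hu.infConvSmoothing_eq hgp ha]
  exact hmin y b hy

/-- The optimality condition at a proximal point. -/
theorem IsProx.gradient_mem_convexSubdiff [CompleteSpace E] {g : E → EReal} {ω : E → ℝ}
    (hgc : Convex ℝ (epi g)) (hc : ConvexOn ℝ Set.univ ω) (hd : Differentiable ℝ ω) {L : NNReal}
    (hL : LipschitzWith L (gradient ω)) {μ : ℝ} (hμ : 0 < μ) {x u : E} (h : IsProx g ω μ x u) :
    gradient ω (μ⁻¹ • (x - u)) ∈ convexSubdiff g u := by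
  obtain ⟨a, ha, hmin⟩ := h
  refine ⟨a, ha, fun y b hy => ?_⟩
  set v := gradient ω (μ⁻¹ • (x - u)) with hv
  -- Compare `u` with `u + t (y - u)` and divide by `t`.
  have key : ∀ t ∈ Set.Ioo (0 : ℝ) 1, a + inner ℝ v (y - u) ≤ b + t * (L / μ * ‖y - u‖ ^ 2) := by
    rintro t ⟨ht₀, ht₁⟩
    have h₁ := hmin _ _ (le_segment hgc ha.le hy ht₀.le ht₁.le)
    have h₂ := rescale_le_add_inner_add_sq hc hd hL hμ (x - u) (x - (u + t • (y - u)))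
    have h₃ : x - (u + t • (y - u)) - (x - u) = -(t • (y - u)) := by abel
    rw [h₃, ← hv, inner_neg_right, inner_smul_right, norm_neg, norm_smul,
      Real.norm_of_nonneg ht₀.le, mul_pow] at h₂
    refine le_of_mul_le_mul_left ?_ ht₀
    linarith
  have hlim : Tendsto (fun t : ℝ => b + t * (L / μ * ‖y - u‖ ^ 2)) (𝓝[>] 0) (𝓝 b) := by
    have : Continuous fun t : ℝ => b + t * (L / μ * ‖y - u‖ ^ 2) := by fun_prop
    simpa using (this.tendsto 0).mono_left nhdsWithin_le_nhds
  exact ge_of_tendsto hlim (mem_of_superset (Ioo_mem_nhdsGT one_pos) key)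

/-- The converse of the optimality condition. -/
theorem isProx_of_gradient_mem [CompleteSpace E] {g : E → EReal} {ω : E → ℝ}
    (hc : ConvexOn ℝ Set.univ ω) (hd : Differentiable ℝ ω) {μ : ℝ} (hμ : 0 < μ) {x u : E}
    (h : gradient ω (μ⁻¹ • (x - u)) ∈ convexSubdiff g u) : IsProx g ω μ x u := by
  obtain ⟨a, ha, hv⟩ := h
  refine ⟨a, ha, fun y b hy => ?_⟩
  have h₁ := hv y b hy
  have h₂ := rescale_add_inner_le hc hd hμ (x - u) (x - y)
  rw [sub_sub_sub_cancel_left, ← neg_sub y u, inner_neg_right] at h₂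
  linarith

/-! ### Differentiability of the smoothing -/

/-- The smoothing lies above its tangent at `x`, whose slope is `∇ω ((x - u) / μ)`. -/
theorem IsProx.add_inner_le [ProperSpace E] {g : E → EReal} {ω : E → ℝ} (hgp : Proper g)
    (hg : LowerSemicontinuous g) (hgc : Convex ℝ (epi g)) (hc : ConvexOn ℝ Set.univ ω)
    (hd : Differentiable ℝ ω) {L : NNReal} (hL : LipschitzWith L (gradient ω))
    (hωc : OneCoercive ω) {μ : ℝ} (hμ : 0 < μ) {x u : E} (h : IsProx g ω μ x u) (y : E) :
    infConvSmoothing g ω x μ + inner ℝ (gradient ω (μ⁻¹ • (x - u))) (y - x) ≤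
      infConvSmoothing g ω y μ := by
  obtain ⟨a, ha, hsub⟩ := h.gradient_mem_convexSubdiff hgc hc hd hL hμ
  obtain ⟨u', h'⟩ := exists_isProx hgp hg hgc hd.continuous hωc hμ y
  obtain ⟨a', ha', -⟩ := id h'
  rw [h.infConvSmoothing_eq hgp ha, h'.infConvSmoothing_eq hgp ha']
  have h₁ := hsub u' a' ha'.le
  have h₂ := rescale_add_inner_le hc hd hμ (x - u) (y - u')
  have h₃ : y - u' - (x - u) = y - x - (u' - u) := by abel
  rw [h₃, inner_sub_right] at h₂
  linarith

theorem IsProx.le_add_inner_add_sq [ProperSpace E] {g : E → EReal} {ω : E → ℝ} (hgp : Proper g)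
    (hg : LowerSemicontinuous g) (hgc : Convex ℝ (epi g)) (hc : ConvexOn ℝ Set.univ ω)
    (hd : Differentiable ℝ ω) {L : NNReal} (hL : LipschitzWith L (gradient ω))
    (hωc : OneCoercive ω) {μ : ℝ} (hμ : 0 < μ) {x u : E} (h : IsProx g ω μ x u) (y : E) :
    infConvSmoothing g ω y μ ≤ infConvSmoothing g ω x μ +
      inner ℝ (gradient ω (μ⁻¹ • (x - u))) (y - x) + L / μ * ‖y - x‖ ^ 2 := by
  obtain ⟨a, ha, -⟩ := id h
  have h₁ := infConvSmoothing_le hgp hg hgc hd.continuous hωc hμ y ha.le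
  have h₂ := rescale_le_add_inner_add_sq hc hd hL hμ (x - u) (y - u)
  rw [sub_sub_sub_cancel_right] at h₂
  rw [h.infConvSmoothing_eq hgp ha]
  linarith

theorem hasGradientAt_of_quadratic_bounds [CompleteSpace E] {s : E → ℝ} {x v : E} {K : ℝ}
    (hlow : ∀ y, s x + inner ℝ v (y - x) ≤ s y)
    (hup : ∀ y, s y ≤ s x + inner ℝ v (y - x) + K * ‖y - x‖ ^ 2) : HasGradientAt s v x := by
  rw [hasGradientAt_iff_isLittleO]
  refine IsBigO.trans_isLittleO (g := fun y => ‖y - x‖ ^ 2) (.of_bound K ?_) ?_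
  · refine Eventually.of_forall fun y => ?_
    rw [Real.norm_eq_abs, abs_of_nonneg (by linarith [hlow y]), norm_pow, norm_norm]
    linarith [hup y]
  · have h₁ : Tendsto (fun y => ‖y - x‖) (𝓝 x) (𝓝 0) := tendsto_norm_sub_self x
    refine ((isLittleO_pow_id one_lt_two).comp_tendsto h₁).trans_isBigO ?_
    exact (isBigO_refl (fun y => y - x) (𝓝 x)).norm_left

/-- Two-sided quadratic bounds at every point make the gradient Lipschitz: compare the bounds at
`x` and `x'` at the point `x' + h`, with `h` parallel to `v x - v x'` and of norm `‖x - x'‖`. -/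
theorem norm_sub_le_of_quadratic_bounds {s : E → ℝ} {v : E → E} {K : ℝ} (hK : 0 ≤ K)
    (hlow : ∀ x y, s x + inner ℝ (v x) (y - x) ≤ s y)
    (hup : ∀ x y, s y ≤ s x + inner ℝ (v x) (y - x) + K * ‖y - x‖ ^ 2) (x x' : E) :
    ‖v x - v x'‖ ≤ 2 * K * ‖x - x'‖ := by
  have key : ∀ h : E, inner ℝ (v x - v x') h ≤ K * ‖h‖ ^ 2 + K * ‖x - x'‖ ^ 2 := by
    intro h
    have h₁ := hlow x (x' + h)
    have h₂ := hup x' (x' + h)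
    have h₃ := hup x x'
    rw [add_sub_cancel_left] at h₂
    rw [add_sub_right_comm, inner_add_right] at h₁
    rw [norm_sub_rev] at h₃
    rw [inner_sub_left]
    linarith
  rcases eq_or_ne x x' with rfl | hx
  · simp
  have hpos : 0 < ‖x - x'‖ := norm_pos_iff.2 (sub_ne_zero.2 hx)
  set d := v x - v x'
  rcases eq_or_ne d 0 with hd | hd
  · rw [hd, norm_zero]
    positivity
  have hdpos : 0 < ‖d‖ := norm_pos_iff.2 hd
  have h := key ((‖x - x'‖ / ‖d‖) • d)
  rw [inner_smul_right, real_inner_self_eq_norm_sq, norm_smul,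
    Real.norm_of_nonneg (by positivity), div_mul_cancel₀ _ hdpos.ne'] at h
  refine le_of_mul_le_mul_left ?_ hpos
  calc ‖x - x'‖ * ‖d‖ = ‖x - x'‖ / ‖d‖ * ‖d‖ ^ 2 := by field_simp
    _ ≤ _ := h
    _ = _ := by ring

theorem IsProx.hasGradientAt [ProperSpace E] {g : E → EReal} {ω : E → ℝ} (hgp : Proper g)
    (hg : LowerSemicontinuous g) (hgc : Convex ℝ (epi g)) (hc : ConvexOn ℝ Set.univ ω)
    (hd : Differentiable ℝ ω) {L : NNReal} (hL : LipschitzWith L (gradient ω))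
    (hωc : OneCoercive ω) {μ : ℝ} (hμ : 0 < μ) {x u : E} (h : IsProx g ω μ x u) :
    HasGradientAt (fun y => infConvSmoothing g ω y μ) (gradient ω (μ⁻¹ • (x - u))) x :=
  hasGradientAt_of_quadratic_bounds (h.add_inner_le hgp hg hgc hc hd hL hωc hμ)
    (h.le_add_inner_add_sq hgp hg hgc hc hd hL hωc hμ)

theorem contDiff_infConvSmoothing [ProperSpace E] {g : E → EReal} {ω : E → ℝ} (hgp : Proper g)
    (hg : LowerSemicontinuous g) (hgc : Convex ℝ (epi g)) (hc : ConvexOn ℝ Set.univ ω)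
    (hd : Differentiable ℝ ω) {L : NNReal} (hL : LipschitzWith L (gradient ω))
    (hωc : OneCoercive ω) {μ : ℝ} (hμ : 0 < μ) :
    ContDiff ℝ 1 (fun x => infConvSmoothing g ω x μ) := by
  choose u hu using exists_isProx hgp hg hgc hd.continuous hωc hμ
  have hgrad := fun x => (hu x).hasGradientAt hgp hg hgc hc hd hL hωc hμ
  rw [contDiff_one_iff_fderiv]
  refine ⟨fun x => (hgrad x).differentiableAt, ?_⟩
  have hcont : Continuous fun x => gradient ω (μ⁻¹ • (x - u x)) := by
    refine (LipschitzWith.of_dist_le_mul (K := 2 * (L / ⟨μ, hμ.le⟩)) fun x y => ?_).continuous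
    rw [dist_eq_norm, dist_eq_norm]
    exact norm_sub_le_of_quadratic_bounds (v := fun x => gradient ω (μ⁻¹ • (x - u x)))
      (div_nonneg L.2 hμ.le)
      (fun x => (hu x).add_inner_le hgp hg hgc hc hd hL hωc hμ)
      (fun x => (hu x).le_add_inner_add_sq hgp hg hgc hc hd hL hωc hμ) x y
  exact ((InnerProductSpace.toDual ℝ E).continuous.comp hcont).congr
    fun x => (hgrad x).hasFDerivAt.fderiv.symm

/-! ### Limits as the parameter tends to zero -/

theorem innerLim_subset_outerLim {X : Type*} [TopologicalSpace X] (C : ℕ → Set X) :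
    innerLim C ⊆ outerLim C := by
  rintro x ⟨y, hy, hx⟩
  obtain ⟨N, hN⟩ := eventually_atTop.1 hy
  refine ⟨fun k => k + N, fun _ _ h => Nat.add_lt_add_right h N, fun k => y (k + N),
    fun k => hN _ (Nat.le_add_left N k), hx.comp (tendsto_add_atTop_nat N)⟩

theorem SetConverges.of_subset {X : Type*} [TopologicalSpace X] {C : ℕ → Set X} {D : Set X}
    (h₁ : outerLim C ⊆ D) (h₂ : D ⊆ innerLim C) : SetConverges C D :=
  ⟨h₁.antisymm (h₂.trans (innerLim_subset_outerLim C)),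
    ((innerLim_subset_outerLim C).trans h₁).antisymm h₂⟩

/-- The outer limit of the epigraphs: by `norm_sub_le_of_value_le` the proximal points of `x k` have
the same limit as `x k`, because `M` is arbitrary there. -/
theorem le_of_tendsto_infConvSmoothing_le [ProperSpace E] {g : E → EReal} {ω : E → ℝ}
    (hgp : Proper g) (hg : LowerSemicontinuous g) (hgc : Convex ℝ (epi g)) (hω : Continuous ω)
    (hωc : OneCoercive ω) {μ α : ℕ → ℝ} {x : ℕ → E} {x₀ : E} {α₀ : ℝ}
    (hμ : Tendsto μ atTop (𝓝[>] 0)) (hx : Tendsto x atTop (𝓝 x₀)) (hα : Tendsto α atTop (𝓝 α₀))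
    (h : ∀ k, infConvSmoothing g ω (x k) (μ k) ≤ α k) : g x₀ ≤ α₀ := by
  have hμ₀ : Tendsto μ atTop (𝓝 0) := hμ.mono_right nhdsWithin_le_nhds
  have hpos : ∀ᶠ k in atTop, 0 < μ k := hμ.eventually self_mem_nhdsWithin
  -- `μ k` is positive only eventually; elsewhere `u k` is irrelevant.
  have hprox : ∀ k, ∃ u, 0 < μ k → IsProx g ω (μ k) (x k) u := fun k => by
    by_cases hk : 0 < μ k
    · obtain ⟨u, hu⟩ := exists_isProx hgp hg hgc hω hωc hk (x k)
      exact ⟨u, fun _ => hu⟩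
    · exact ⟨0, fun h => absurd h hk⟩
  choose u hu using hprox
  obtain ⟨p, β, hp⟩ := exists_affine_minorant hgp hg hgc
  have hval : ∀ k, 0 < μ k → ∃ a : ℝ, g (u k) = a ∧ a + rescale ω (μ k) (x k - u k) ≤ α k :=
    fun k hk => by
      obtain ⟨a, ha, -⟩ := id (hu k hk)
      exact ⟨a, ha, ((hu k hk).infConvSmoothing_eq hgp ha).symm.trans_le (h k)⟩
  have hdist : Tendsto (fun k => ‖x k - u k‖) atTop (𝓝 0) := by
    set B := α₀ + β + ‖p‖ * ‖x₀‖ + 1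
    refine (nhds_basis_abs_sub_lt (0 : ℝ)).tendsto_right_iff.2 fun ε hε => ?_
    -- With this `M` the factor `M - ‖p‖` is `(|B| + 1) / ε`.
    obtain ⟨C, hC⟩ := hωc.exists_le hω (‖p‖ + (|B| + 1) / ε)
    have hlim : Tendsto (fun k => α k + β + ‖p‖ * ‖x k‖ + μ k * C) atTop
        (𝓝 (α₀ + β + ‖p‖ * ‖x₀‖ + 0 * C)) :=
      ((hα.add_const β).add (hx.norm.const_mul _)).add (hμ₀.mul_const C)
    filter_upwards [hpos, hlim.eventually (gt_mem_nhds (show _ < B by linarith))] with k hk hkB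
    obtain ⟨a, ha, hle⟩ := hval k hk
    have h₁ := norm_sub_le_of_value_le hp hC hk ha.le hle
    rw [add_sub_cancel_left] at h₁
    have h₂ : (|B| + 1) / ε * ‖x k - u k‖ < (|B| + 1) / ε * ε := by
      rw [div_mul_cancel₀ _ hε.ne']
      linarith [le_abs_self B]
    rw [sub_zero, abs_norm]
    exact lt_of_mul_lt_mul_left h₂ (by positivity)
  have hux : Tendsto u atTop (𝓝 x₀) := by
    simpa using hx.sub (tendsto_zero_iff_norm_tendsto_zero.2 hdist)
  obtain ⟨C, hC⟩ := hωc.exists_le hω 0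
  have hlim : Tendsto (fun k => α k + μ k * C) atTop (𝓝 α₀) := by
    simpa using hα.add (hμ₀.mul_const C)
  refine le_of_tendsto_epi hg hux hlim ?_
  filter_upwards [hpos] with k hk
  obtain ⟨a, ha, hle⟩ := hval k hk
  rw [ha, EReal.coe_le_coe_iff]
  linarith [rescale_ge hC hk (x k - u k)]

theorem epiConverges_infConvSmoothing [ProperSpace E] {g : E → EReal} {ω : E → ℝ}
    (hgp : Proper g) (hg : LowerSemicontinuous g) (hgc : Convex ℝ (epi g)) (hω : Continuous ω)
    (hωc : OneCoercive ω) {μ : ℕ → ℝ} (hμ : Tendsto μ atTop (𝓝[>] 0)) :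
    EpiConverges (fun k x => ((infConvSmoothing g ω x (μ k) : ℝ) : EReal)) g := by
  refine SetConverges.of_subset ?_ ?_
  · rintro ⟨x₀, α₀⟩ ⟨φ, hφ, y, hy, hlim⟩
    exact le_of_tendsto_infConvSmoothing_le hgp hg hgc hω hωc (hμ.comp hφ.tendsto_atTop)
      hlim.fst_nhds hlim.snd_nhds fun k => EReal.coe_le_coe_iff.1 (hy k)
  · rintro ⟨x₀, α₀⟩ hx
    -- The competitor `u = x₀` in the infimum.
    refine ⟨fun k => (x₀, α₀ + μ k * ω 0), ?_, ?_⟩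
    · filter_upwards [hμ.eventually self_mem_nhdsWithin] with k hk
      have := infConvSmoothing_le hgp hg hgc hω hωc hk x₀ hx
      refine EReal.coe_le_coe_iff.2 ?_
      simpa [rescale] using this
    · have := (hμ.mono_right nhdsWithin_le_nhds).mul_const (ω 0)
      simpa using (tendsto_const_nhds (x := x₀)).prodMk_nhds (this.const_add α₀)

/-- Limits of gradients are subgradients: a bounded sequence of gradients of `ω` comes from bounded
points `(x k - u k) / μ k`, so that `u k` has the same limit as `x k`. -/
theorem mem_convexSubdiff_of_tendsto_gradient [ProperSpace E] {g : E → EReal} {ω : E → ℝ}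
    (hgp : Proper g) (hg : LowerSemicontinuous g) (hgc : Convex ℝ (epi g))
    (hc : ConvexOn ℝ Set.univ ω) (hd : Differentiable ℝ ω) {L : NNReal}
    (hL : LipschitzWith L (gradient ω)) (hωc : OneCoercive ω) {μ : ℕ → ℝ} {x : ℕ → E} {x₀ v₀ : E}
    (hμ : Tendsto μ atTop (𝓝[>] 0)) (hx : Tendsto x atTop (𝓝 x₀))
    (hv : Tendsto (fun k => gradient (fun y => infConvSmoothing g ω y (μ k)) (x k)) atTop (𝓝 v₀)) :
    v₀ ∈ convexSubdiff g x₀ := by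
  have hpos : ∀ᶠ k in atTop, 0 < μ k := hμ.eventually self_mem_nhdsWithin
  set v := fun k => gradient (fun y => infConvSmoothing g ω y (μ k)) (x k)
  have hprox : ∀ k, ∃ z, 0 < μ k → gradient ω z = v k ∧ v k ∈ convexSubdiff g (x k - μ k • z) := by
    intro k
    by_cases hk : 0 < μ k
    · obtain ⟨u, hu⟩ := exists_isProx hgp hg hgc hd.continuous hωc hk (x k)
      have h₁ := (hu.hasGradientAt hgp hg hgc hc hd hL hωc hk).gradient
      refine ⟨(μ k)⁻¹ • (x k - u), fun _ => ⟨h₁.symm, ?_⟩⟩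
      rw [smul_inv_smul₀ hk.ne', sub_sub_cancel, show v k = _ from h₁]
      exact hu.gradient_mem_convexSubdiff hgc hc hd hL hk
    · exact ⟨0, fun h => absurd h hk⟩
  choose z hz using hprox
  obtain ⟨C, hC⟩ := hωc.exists_le hd.continuous (‖v₀‖ + 1 + 1)
  have hbdd : ∀ᶠ k in atTop, ‖z k‖ ≤ ω 0 + C := by
    filter_upwards [hpos, hv.norm.eventually (gt_mem_nhds (lt_add_one ‖v₀‖))] with k hk hvk
    have h₁ := convexOn_gradient_le hc hd (z k) 0
    rw [(hz k hk).1, zero_sub, inner_neg_right] at h₁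
    have h₂ := real_inner_le_norm (v k) (z k)
    have h₃ := mul_le_mul_of_nonneg_right hvk.le (norm_nonneg (z k))
    linarith [hC (z k)]
  have hsmul : Tendsto (fun k => μ k • z k) atTop (𝓝 0) := by
    have hμ₀ : Tendsto μ atTop (𝓝 0) := hμ.mono_right nhdsWithin_le_nhds
    have hlim : Tendsto (fun k => μ k * (ω 0 + C)) atTop (𝓝 0) := by
      simpa using hμ₀.mul_const (ω 0 + C)
    refine squeeze_zero_norm' ?_ hlim
    filter_upwards [hpos, hbdd] with k hk hzk
    rw [norm_smul, Real.norm_of_nonneg hk.le]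
    exact mul_le_mul_of_nonneg_left hzk hk.le
  refine mem_convexSubdiff_of_tendsto hgp hg (x := fun k => x k - μ k • z k) ?_ hv ?_
  · simpa using hx.sub hsmul
  · filter_upwards [hpos] with k hk using (hz k hk).2

/-- Every subgradient `v` at `x` is attained exactly along a ray: if `∇ω z = v`, then `x` is the
proximal point of `x + μ z`, for every `μ > 0`. -/
theorem exists_gradient_infConvSmoothing_eq [ProperSpace E] {g : E → EReal} {ω : E → ℝ}
    (hgp : Proper g) (hg : LowerSemicontinuous g) (hgc : Convex ℝ (epi g))
    (hc : ConvexOn ℝ Set.univ ω) (hd : Differentiable ℝ ω) {L : NNReal}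
    (hL : LipschitzWith L (gradient ω)) (hωc : OneCoercive ω) {x v : E}
    (hv : v ∈ convexSubdiff g x) :
    ∃ z, ∀ μ : ℝ, 0 < μ → gradient (fun y => infConvSmoothing g ω y μ) (x + μ • z) = v := by
  obtain ⟨z, hz⟩ := hωc.exists_gradient_eq hd v
  refine ⟨z, fun μ hμ => ?_⟩
  have harg : μ⁻¹ • (x + μ • z - x) = z := by
    rw [add_sub_cancel_left, inv_smul_smul₀ hμ.ne']
  have hprox : IsProx g ω μ (x + μ • z) x :=
    isProx_of_gradient_mem hc hd hμ (by rwa [harg, hz])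
  rw [(hprox.hasGradientAt hgp hg hgc hc hd hL hωc hμ).gradient, harg, hz]

theorem setConverges_gph_gradMap [ProperSpace E] {g : E → EReal} {ω : E → ℝ}
    (hgp : Proper g) (hg : LowerSemicontinuous g) (hgc : Convex ℝ (epi g))
    (hc : ConvexOn ℝ Set.univ ω) (hd : Differentiable ℝ ω) {L : NNReal}
    (hL : LipschitzWith L (gradient ω)) (hωc : OneCoercive ω) {μ : ℕ → ℝ}
    (hμ : Tendsto μ atTop (𝓝[>] 0)) :
    SetConverges (fun k => gph (gradMap (infConvSmoothing g ω) (μ k))) (gph (convexSubdiff g)) := by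
  refine SetConverges.of_subset ?_ ?_
  · rintro ⟨x₀, v₀⟩ ⟨φ, hφ, y, hy, hlim⟩
    refine mem_convexSubdiff_of_tendsto_gradient hgp hg hgc hc hd hL hωc
      (hμ.comp hφ.tendsto_atTop) hlim.fst_nhds (hlim.snd_nhds.congr fun k => hy k)
  · rintro ⟨x₀, v₀⟩ hv
    obtain ⟨z, hz⟩ := exists_gradient_infConvSmoothing_eq hgp hg hgc hc hd hL hωc hv
    refine ⟨fun k => (x₀ + μ k • z, v₀), ?_, ?_⟩
    · filter_upwards [hμ.eventually self_mem_nhdsWithin] with k hk using (hz _ hk).symm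
    · have := (hμ.mono_right nhdsWithin_le_nhds).smul_const z
      simpa using (this.const_add x₀).prodMk_nhds (tendsto_const_nhds (x := v₀))

theorem mapLimsup_gradMap [ProperSpace E] {g : E → EReal} {ω : E → ℝ}
    (hgp : Proper g) (hg : LowerSemicontinuous g) (hgc : Convex ℝ (epi g))
    (hc : ConvexOn ℝ Set.univ ω) (hd : Differentiable ℝ ω) {L : NNReal}
    (hL : LipschitzWith L (gradient ω)) (hωc : OneCoercive ω) (x₀ : E) :
    mapLimsup (fun p : E × ℝ => gradMap (infConvSmoothing g ω) p.2 p.1) (𝓝 x₀ ×ˢ 𝓝[>] 0) =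
      convexSubdiff g x₀ := by
  ext v
  constructor
  · rintro ⟨p, hp, w, hw, hlim⟩
    exact mem_convexSubdiff_of_tendsto_gradient hgp hg hgc hc hd hL hωc hp.snd hp.fst
      (hlim.congr fun k => hw k)
  · intro hv
    obtain ⟨z, hz⟩ := exists_gradient_infConvSmoothing_eq hgp hg hgc hc hd hL hωc hv
    have hμ : Tendsto (fun k : ℕ => 1 / ((k : ℝ) + 1)) atTop (𝓝[>] 0) :=
      tendsto_nhdsWithin_iff.2 ⟨tendsto_one_div_add_atTop_nhds_zero_nat,
        Eventually.of_forall fun _ => Set.mem_Ioi.2 Nat.one_div_pos_of_nat⟩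
    refine ⟨fun k => (x₀ + (1 / ((k : ℝ) + 1)) • z, 1 / ((k : ℝ) + 1)), ?_, fun _ => v,
      fun k => (hz _ Nat.one_div_pos_of_nat).symm, tendsto_const_nhds⟩
    refine Tendsto.prodMk ?_ hμ
    have := (hμ.mono_right nhdsWithin_le_nhds).smul_const z
    simpa using this.const_add x₀

end EpiSmoothing

theorem theorem4p6 (n : ℕ)
    (g : EuclideanSpace ℝ (Fin n) → EReal) (ω : EuclideanSpace ℝ (Fin n) → ℝ)
    (hg_proper : Proper g) (hg_lsc : LowerSemicontinuous g) (hg_convex : Convex ℝ (epi g))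
    (hω_convex : ConvexOn ℝ Set.univ ω) (hω_smooth : ContDiff ℝ 1 ω)
    (hω_lip : ∃ L : NNReal, LipschitzWith L (gradient ω))
    (hω_coercive : OneCoercive ω) :
    -- the infimal convolution is finite, so that `infConvSmoothing g ω` is the real function it is
    (∀ μ : ℝ, 0 < μ → ∀ x, ((infConvSmoothing g ω x μ : ℝ) : EReal) =
      infConv g (fun y => ((rescale ω μ y : ℝ) : EReal)) x) ∧
    IsEpiSmoothing (infConvSmoothing g ω) g ∧
    -- graphical convergence of the gradients as `μ ↓ 0`
    (∀ μ : ℕ → ℝ, Tendsto μ atTop (𝓝[>] 0) →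
      SetConverges (fun k => gph (gradMap (infConvSmoothing g ω) (μ k)))
        (gph (limitingSubdiff g))) ∧
    -- gradient consistency
    (∀ x₀ ∈ dom g,
      mapLimsup (fun p : EuclideanSpace ℝ (Fin n) × ℝ => gradMap (infConvSmoothing g ω) p.2 p.1)
        (𝓝 x₀ ×ˢ 𝓝[>] 0) = limitingSubdiff g x₀) := by
  obtain ⟨L, hL⟩ := hω_lip
  have hd : Differentiable ℝ ω := hω_smooth.differentiable one_ne_zero
  rw [limitingSubdiff_eq_convexSubdiff hg_proper hg_lsc hg_convex]
  refine ⟨fun μ hμ x => ?_, ⟨fun μ hμ => ?_, fun μ hμ => ?_⟩, fun μ hμ => ?_, fun x₀ _ => ?_⟩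
  · obtain ⟨u, hu⟩ := exists_isProx hg_proper hg_lsc hg_convex hd.continuous hω_coercive hμ x
    obtain ⟨a, ha, -⟩ := id hu
    rw [hu.infConvSmoothing_eq hg_proper ha, hu.infConv_eq hg_proper ha]
  · exact epiConverges_infConvSmoothing hg_proper hg_lsc hg_convex hd.continuous hω_coercive hμ
  · exact contDiff_infConvSmoothing hg_proper hg_lsc hg_convex hω_convex hd hL hω_coercive hμ
  · exact setConverges_gph_gradMap hg_proper hg_lsc hg_convex hω_convex hd hL hω_coercive hμ
  · exact mapLimsup_gradMap hg_proper hg_lsc hg_convex hω_convex hd hL hω_coercive x₀
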